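/- All Hilbert spaces are complex. A subproduct system (of Hilbert spaces) over the semigroup $\mathbb N^3$ is a family $X=\{X(s)\}_{s\in\mathbb N^3}$ of Hilbert spaces with $X(0)=\mathbb C$, together with coisometric linear maps $U^X_{s,t}:X(s)\otimes X(t)\to X(s+t)$ such that $U^X_{s,0}$ and $U^X_{0,s}$ are scalar multiplication and $U^X_{s+t,r}(U^X_{s,t}\otimes I)=U^X_{s,t+r}(I\otimes U^X_{t,r})$ for all $s,t,r$. It is a product system if all $U^X_{s,t}$ are unitary. $X$ is a subsystem of $Y$ if, up to isometric identification, each $X(s)$ is a closed subspace of $Y(s)$ and the orthogonal projections $p_s:Y(s)\to X(s)$ satisfy $p_{s+t}U^Y_{s,t}=U^X_{s,t}(p_s\otimes p_t)$ for all $s,t$. A $cp$-semigroup over $\mathbb N^3$ on $B(H)$ is a family $\Theta=\{\Theta_n\}_{n\in\mathbb N^3}$ of normal, contractive, completely positive maps on $B(H)$ with $\Theta_0=\mathrm{id}$ and $\Theta_{m+n}=\Theta_m\circ\Theta_n$. For $\lambda>0$, $\lambda\Theta$ denotes the family $(\lambda\Theta)_n=\lambda^{n_1+n_2+n_3}\Theta_n$,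 that is, the one generated by $\lambda\Theta_{e_1},\lambda\Theta_{e_2},\lambda\Theta_{e_3}$, where $e_1,e_2,e_3$ is the standard basis of $\mathbb N^3$. An $e$-dilation of a family $\Phi=\{\Phi_n\}_{n\in\mathbb N^3}$ of maps on $B(H)$ is a triple $(\alpha,K,\mathcal R)$, where $K\supseteq H$ is a Hilbert space with orthogonal projection $P_H$ onto $H$, $\mathcal R\subseteq B(K)$ is a von Neumann algebra that contains $B(H)=P_H\mathcal R P_H$ as a corner, and $\alpha=\{\alpha_n\}_{n\in\mathbb N^3}$ is a semigroup of normal, not necessarily unital $*$-endomorphisms of $\mathcal R$ with $\alpha_0=\mathrm{id}$, such that $\Phi_n(P_HTP_H)=P_H\alpha_n(T)P_H$ for all $T\in\mathcal R$ and $n\in\mathbb N^3$. It is minimal if the central support of $P_H$ in $\mathcal R$ is $I_K$ and $\mathcal R$ is the von Neumann algebra generated by $\bigcup_n\alpha_n(B(H))$. **Theorem.** 1. There is a subproduct system $X$ over $\mathbb N^3$ with $X(e_i)=\mathbb C^2$ for $i=1,2,3$, $X(e_i+e_j)=\mathbb C^2\otimes\mathbb C^2$ for all $i,j$, and $X(n)=\{0\}$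 whenever $n_1+n_2+n_3>2$, such that $U^X_{e_i,e_j}$ is the identity of $\mathbb C^2\otimes\mathbb C^2$ for all $(i,j)\ne(3,2)$ and $U^X_{e_3,e_2}$ is the flip $x\otimes y\mapsto y\otimes x$, and $X$ is not a subsystem of any product system over $\mathbb N^3$. 2. There are a Hilbert space $H$ and a $cp$-semigroup $\Theta$ over $\mathbb N^3$ on $B(H)$ such that, for every $\lambda>0$, $\lambda\Theta$ has no $e$-dilation $(\alpha,K,B(K))$ on any Hilbert space $K$ and no minimal $e$-dilation $(\alpha,K,\mathcal R)$ on any von Neumann algebra $\mathcal R$. -/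

import Mathlib

open scoped TensorProduct InnerProduct CStarAlgebra

universe u v w

noncomputable section

/-! ## Subproduct systems of Hilbert spaces -/

/-- The Hilbert space tensor product of `E` and `F`: the completion of the algebraic tensor product
for the inner product `⟪x ⊗ y, x' ⊗ y'⟫ = ⟪x, x'⟫ ⟪y, y'⟫`. -/
abbrev HilbertTensor (E : Type u) (F : Type v)
    [NormedAddCommGroup E] [InnerProductSpace ℂ E]
    [NormedAddCommGroup F] [InnerProductSpace ℂ F] : Type (max u v) :=
  UniformSpace.Completion (E ⊗[ℂ] F)

/-- The elementary tensor `x ⊗ y` in the Hilbert space tensor product. -/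
def HilbertTensor.mk {E : Type u} {F : Type v}
    [NormedAddCommGroup E] [InnerProductSpace ℂ E]
    [NormedAddCommGroup F] [InnerProductSpace ℂ F] (x : E) (y : F) : HilbertTensor E F :=
  ((x ⊗ₜ[ℂ] y : E ⊗[ℂ] F) : UniformSpace.Completion (E ⊗[ℂ] F))

/-- A subproduct system of Hilbert spaces (that is, of `W*`-correspondences over `ℂ`) over the
semigroup `S`: Hilbert spaces `X(s)` with `X(0) = ℂ` and coisometric maps
`U_{s,t} : X(s) ⊗ X(t) → X(s + t)` which are associative and for which `U_{0,s}` and `U_{s,0}` are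
the left and right actions of `ℂ`.

The map `U_{s,t}` is `mul h` with `h : s + t = r`; naming the index `r` of the target avoids
transporting vectors along equalities such as `(s + t) + r = s + (t + r)`.
The identification of `X(0)` with `ℂ` is `zeroIso`. -/
structure SubproductSystem (S : Type u) [AddMonoid S] where
  fiber : S → Type v
  [normedAddCommGroup : ∀ s, NormedAddCommGroup (fiber s)]
  [innerProductSpace : ∀ s, InnerProductSpace ℂ (fiber s)]
  [completeSpace : ∀ s, CompleteSpace (fiber s)]
  mul : ∀ {s t r : S}, s + t = r → (HilbertTensor (fiber s) (fiber t) →L[ℂ] fiber r)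
  coisometric : ∀ {s t r : S} (h : s + t = r),
    mul h ∘L ContinuousLinearMap.adjoint (mul h) = ContinuousLinearMap.id ℂ (fiber r)
  zeroIso : ℂ ≃ₗᵢ[ℂ] fiber 0
  zero_mul : ∀ (s : S) (c : ℂ) (x : fiber s),
    mul (zero_add s) (HilbertTensor.mk (zeroIso c) x) = c • x
  mul_zero : ∀ (s : S) (c : ℂ) (x : fiber s),
    mul (add_zero s) (HilbertTensor.mk x (zeroIso c)) = c • x
  assoc : ∀ {s t r st tr str : S} (h₁ : s + t = st) (h₂ : st + r = str)
    (h₃ : t + r = tr) (h₄ : s + tr = str) (x : fiber s) (y : fiber t) (z : fiber r),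
    mul h₂ (HilbertTensor.mk (mul h₁ (HilbertTensor.mk x y)) z) =
      mul h₄ (HilbertTensor.mk x (mul h₃ (HilbertTensor.mk y z)))

attribute [instance] SubproductSystem.normedAddCommGroup SubproductSystem.innerProductSpace
  SubproductSystem.completeSpace

namespace SubproductSystem

/-- A (full) product system is a subproduct system whose product maps are unitary; as they are
coisometric already, what is required is that they are isometric. -/
def IsProductSystem {S : Type u} [AddMonoid S] (Y : SubproductSystem.{u, v} S) : Prop :=
  ∀ {s t r : S} (h : s + t = r),
    ContinuousLinearMap.adjoint (Y.mul h) ∘L Y.mul h =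
      ContinuousLinearMap.id ℂ (HilbertTensor (Y.fiber s) (Y.fiber t))

/-- `X` is (up to the identification of each `X(s)` with a closed subspace of `Y(s)` by an isometry
`ι s`) a subproduct subsystem of `Y`: the projections `p_s = (ι s)* : Y(s) → X(s)` satisfy
`p_{s+t} ∘ U^Y_{s,t} = U^X_{s,t} ∘ (p_s ⊗ p_t)`. -/
def IsSubsystem {S : Type u} [AddMonoid S] (X : SubproductSystem.{u, v} S)
    (Y : SubproductSystem.{u, w} S) : Prop :=
  ∃ ι : ∀ s, X.fiber s →ₗᵢ[ℂ] Y.fiber s,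
    ∀ {s t r : S} (h : s + t = r) (x : Y.fiber s) (y : Y.fiber t),
      ContinuousLinearMap.adjoint (ι r).toContinuousLinearMap (Y.mul h (HilbertTensor.mk x y)) =
        X.mul h (HilbertTensor.mk
          (ContinuousLinearMap.adjoint (ι s).toContinuousLinearMap x)
          (ContinuousLinearMap.adjoint (ι t).toContinuousLinearMap y))

/-- The fibres and products of `X` over `ℕ³`, with standard basis `e₁, e₂, e₃` (here indexed by
`0, 1, 2`), are: `X(e_i) = ℂ²`, `X(n) = ℂ² ⊗ ℂ²` if `|n| = 2`, `X(n) = 0` if `|n| > 2`, and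
`U_{e_i,e_j}` is the identity of `ℂ² ⊗ ℂ²` except that `U_{e₃,e₂}` is the flip. -/
def HasFlipFibers (X : SubproductSystem.{0, v} (Fin 3 → ℕ)) : Prop :=
  ∃ (φ : ∀ i : Fin 3, EuclideanSpace ℂ (Fin 2) ≃ₗᵢ[ℂ] X.fiber (Pi.single i 1))
    (ψ : ∀ n : Fin 3 → ℕ, ∑ i, n i = 2 →
      (EuclideanSpace ℂ (Fin 2) ⊗[ℂ] EuclideanSpace ℂ (Fin 2) ≃ₗᵢ[ℂ] X.fiber n)),
    (∀ n : Fin 3 → ℕ, 2 < ∑ i, n i → Subsingleton (X.fiber n)) ∧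
    ∀ (i j : Fin 3) (n : Fin 3 → ℕ) (h : Pi.single i 1 + Pi.single j 1 = n)
      (hn : ∑ i, n i = 2) (x y : EuclideanSpace ℂ (Fin 2)),
      X.mul h (HilbertTensor.mk (φ i x) (φ j y)) =
        if i = 2 ∧ j = 1 then ψ n hn (y ⊗ₜ[ℂ] x) else ψ n hn (x ⊗ₜ[ℂ] y)

end SubproductSystem

/-! ## `cp`-semigroups and `e`-dilations -/

/-- A `cp`-semigroup over `S` acting on `B(H)`: a semigroup of completely positive, contractive,
normal maps with `Θ₀ = id`. A positive linear map of von Neumann algebras is normal if it preserves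
suprema of bounded increasing nets, that is, if it is Scott continuous for the operator order. -/
structure CPSemigroup (S : Type u) [AddMonoid S] (H : Type v)
    [NormedAddCommGroup H] [InnerProductSpace ℂ H] [CompleteSpace H] where
  map : S → ((H →L[ℂ] H) →CP (H →L[ℂ] H))
  contractive : ∀ s a, ‖map s a‖ ≤ ‖a‖
  normal : ∀ s, ScottContinuous (map s)
  map_zero : ∀ a, map 0 a = a
  map_add : ∀ s t a, map (s + t) a = map s (map t a)

/-- An `e`-semigroup over `S` acting on a von Neumann algebra `R ⊆ B(K)`: a semigroup of normal, not
necessarily unital `*`-endomorphisms with `α₀ = id` (complete positivity and contractivity are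
automatic). The order on `R` is that of `B(K)`. -/
structure ESemigroup (S : Type u) [AddMonoid S] {K : Type w}
    [NormedAddCommGroup K] [InnerProductSpace ℂ K] [CompleteSpace K]
    (R : VonNeumannAlgebra K) where
  map : S → (R.toStarSubalgebra →⋆ₙₐ[ℂ] R.toStarSubalgebra)
  normal : ∀ s, ScottContinuous (map s)
  map_zero : ∀ a, map 0 a = a
  map_add : ∀ s t a, map (s + t) a = map s (map t a)

/-- The compression `T ↦ P_H T P_H` from `B(K)` to `B(H)`, where `H ⊆ K` through the isometry `V`. -/
def compress {H : Type v} {K : Type w}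
    [NormedAddCommGroup H] [InnerProductSpace ℂ H] [CompleteSpace H]
    [NormedAddCommGroup K] [InnerProductSpace ℂ K] [CompleteSpace K]
    (V : H →ₗᵢ[ℂ] K) (T : K →L[ℂ] K) : H →L[ℂ] H :=
  ContinuousLinearMap.adjoint V.toContinuousLinearMap ∘L T ∘L V.toContinuousLinearMap

/-- The copy of `a ∈ B(H)` in the corner `P_H B(K) P_H`, where `H ⊆ K` through the isometry `V`. -/
def cornerEmbed {H : Type v} {K : Type w}
    [NormedAddCommGroup H] [InnerProductSpace ℂ H] [CompleteSpace H]
    [NormedAddCommGroup K] [InnerProductSpace ℂ K] [CompleteSpace K]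
    (V : H →ₗᵢ[ℂ] K) (a : H →L[ℂ] H) : K →L[ℂ] K :=
  V.toContinuousLinearMap ∘L a ∘L ContinuousLinearMap.adjoint V.toContinuousLinearMap

/-- An `e`-dilation `(α, K, R)` of a family of maps `Θ s` on `B(H)`: the Hilbert space `K` contains
`H` (through the isometry `incl`), `R ⊆ B(K)` is a von Neumann algebra which contains
`B(H) = P_H R P_H` as a corner, `α` is an `e`-semigroup on `R`, and
`Θ_s (P_H T P_H) = P_H α_s(T) P_H` for all `T ∈ R` and all `s`. -/
structure EDilation {S : Type u} [AddMonoid S] {H : Type v}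
    [NormedAddCommGroup H] [InnerProductSpace ℂ H] [CompleteSpace H]
    (Θ : S → (H →L[ℂ] H) → (H →L[ℂ] H)) (K : Type w)
    [NormedAddCommGroup K] [InnerProductSpace ℂ K] [CompleteSpace K] where
  incl : H →ₗᵢ[ℂ] K
  algebra : VonNeumannAlgebra K
  α : ESemigroup S algebra
  corner : ∀ a : H →L[ℂ] H, cornerEmbed incl a ∈ algebra.toStarSubalgebra
  dilates : ∀ (s : S) (T : algebra.toStarSubalgebra),
    Θ s (compress incl (T : K →L[ℂ] K)) = compress incl (α.map s T : K →L[ℂ] K)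

namespace EDilation

variable {S : Type u} [AddMonoid S] {H : Type v}
  [NormedAddCommGroup H] [InnerProductSpace ℂ H] [CompleteSpace H]
  {Θ : S → (H →L[ℂ] H) → (H →L[ℂ] H)} {K : Type w}
  [NormedAddCommGroup K] [InnerProductSpace ℂ K] [CompleteSpace K]

/-- The dilation acts on all of `B(K)`. -/
def IsOnFullAlgebra (D : EDilation Θ K) : Prop :=
  ∀ T : K →L[ℂ] K, T ∈ D.algebra

/-- The dilation `(α, K, R)` is minimal: the central support of `P_H` in `R` (the least projection
`z` of the centre `R ∩ R'` with `z P_H = P_H`) is `I_K`, and `R` is the von Neumann algebra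
(double commutant) generated by the union of the sets `α_s(B(H))`. -/
def IsMinimal (D : EDilation Θ K) : Prop :=
  IsLeast {z : K →L[ℂ] K | IsStarProjection z ∧ z ∈ D.algebra ∧ z ∈ D.algebra.commutant ∧
      z * cornerEmbed D.incl 1 = cornerEmbed D.incl 1} 1 ∧
  (D.algebra : Set (K →L[ℂ] K)) = Set.centralizer (Set.centralizer
    {T : K →L[ℂ] K | ∃ (s : S) (a : H →L[ℂ] H),
      T = (D.α.map s ⟨cornerEmbed D.incl a, D.corner a⟩ : K →L[ℂ] K)})

end EDilation

/-- The family `λ Θ`: if `Θ` is generated by `θ_i = Θ_{e_i}`, it is the family generated by the maps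
`λ θ_i`, so that `(λ Θ)_n = λ^{|n|} Θ_n`. -/
def CPSemigroup.scale {k : ℕ} {H : Type v}
    [NormedAddCommGroup H] [InnerProductSpace ℂ H] [CompleteSpace H]
    (lam : ℝ) (Θ : CPSemigroup (Fin k → ℕ) H) :
    (Fin k → ℕ) → (H →L[ℂ] H) → (H →L[ℂ] H) :=
  fun n a => ((lam : ℂ) ^ (∑ i, n i)) • Θ.map n a

end

/-! Both statements rest on one fact: the exchange rules between the three colours violate the braid
relation. Write f_i^k for the k-th basis vector in degree e_i, with colours i = 0, 1, 2 and letters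
k = 0, 1. The rules are f_0^k f_i^l = f_i^k f_0^l for i = 1, 2, and f_1^k f_2^l = f_2^l f_1^k. If
products are associative and isometric, reversing the colours of f_0^0 f_1^1 f_2^0 in the two
possible ways gives f_2^1 f_1^0 f_0^0 = f_2^0 f_1^0 f_0^1, an equality of orthogonal unit vectors.

Part 1: products in X of vectors of degrees e_i and e_j keep the norm, so in a product system
containing X these products already lie in X and obey the same rules
(`HasFlipFibers.not_isSubsystem`). X itself exists because words are truncated at length two:
associativity of three nontrivial factors is never tested.

Part 2: let the f_i^k act as creation operators S_{i,k} on a truncated Fock space with vacuum Ω, and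
let θ_i(a) = ∑_k S_{i,k} a S_{i,k}*. The flip only permutes the summands of θ_i θ_j, so the θ_i
commute. A dilation α on B(K) yields operators T_{i,k} v = α_{e_i}(|v⟩⟨Ω|) f_i^k on K with T_{i,k}*
T_{i,l} = c δ_{kl}, subject to the same exchange rules (`intertwiner_deg1_deg1`), and the braid
argument applies again (`not_dilation`). The scale λ enters only through the constant c ≠ 0. A
minimal dilation is one on B(K), because R' acts on H, and then on all of K, by scalars
(`IsMinimal.isOnFullAlgebra`). -/

noncomputable section

/-! ### Completely positive maps on `B(H)` -/

section CompletelyPositive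

variable {H : Type u} [NormedAddCommGroup H] [InnerProductSpace ℂ H] [CompleteSpace H]

/-- A linear map all of whose matrix amplifications are positive. -/
def LinearMap.IsCompletelyPositive (f : (H →L[ℂ] H) →ₗ[ℂ] (H →L[ℂ] H)) : Prop :=
  ∀ (k : ℕ) (M : CStarMatrix (Fin k) (Fin k) (H →L[ℂ] H)), 0 ≤ M → 0 ≤ M.map f

namespace LinearMap.IsCompletelyPositive

variable {f g : (H →L[ℂ] H) →ₗ[ℂ] (H →L[ℂ] H)}

theorem one : IsCompletelyPositive (1 : (H →L[ℂ] H) →ₗ[ℂ] (H →L[ℂ] H)) :=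
  fun _ _ hM => hM

theorem mul (hf : f.IsCompletelyPositive) (hg : g.IsCompletelyPositive) :
    (f * g).IsCompletelyPositive :=
  fun k M hM => hf k _ (hg k M hM)

theorem pow (hf : f.IsCompletelyPositive) (n : ℕ) : (f ^ n).IsCompletelyPositive := by
  induction n with
  | zero => exact one
  | succ n ih => rw [pow_succ]; exact ih.mul hf

theorem add (hf : f.IsCompletelyPositive) (hg : g.IsCompletelyPositive) :
    (f + g).IsCompletelyPositive :=
  fun k M hM => add_nonneg (hf k M hM) (hg k M hM)

/-- The amplification conjugates a matrix by the diagonal matrix with entries `T`. -/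
theorem conj (T : H →L[ℂ] H) :
    (LinearMap.mulLeftRight ℂ (T, star T)).IsCompletelyPositive := by
  intro k M hM
  have hstar : star (CStarMatrix.ofMatrix (Matrix.diagonal fun _ : Fin k => T)) =
      CStarMatrix.ofMatrix (Matrix.diagonal fun _ => star T) := by
    rw [CStarMatrix.star_eq_conjTranspose]
    exact Matrix.diagonal_conjTranspose _
  have h : M.map (LinearMap.mulLeftRight ℂ (T, star T)) =
      CStarMatrix.ofMatrix (Matrix.diagonal fun _ => T) * M *
        star (CStarMatrix.ofMatrix (Matrix.diagonal fun _ => T)) := by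
    rw [hstar]
    refine CStarMatrix.ext fun i j => ?_
    simp [CStarMatrix.mul_apply, Matrix.diagonal_apply]
  rw [h]
  exact star_right_conjugate_nonneg hM _

/-- The bundled completely positive map. -/
def toCP (hf : f.IsCompletelyPositive) : (H →L[ℂ] H) →CP (H →L[ℂ] H) where
  toLinearMap := f
  map_cstarMatrix_nonneg' := hf

@[simp]
theorem toCP_apply (hf : f.IsCompletelyPositive) (a : H →L[ℂ] H) : hf.toCP a = f a := rfl

end LinearMap.IsCompletelyPositive

/-- In finite dimensions the supremum of a directed set of operators lies in its closure. -/
theorem DirectedOn.mem_closure_of_isLUB [FiniteDimensional ℂ H] {d : Set (H →L[ℂ] H)}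
    (hne : d.Nonempty) (hd : DirectedOn (· ≤ ·) d) {a : H →L[ℂ] H} (ha : IsLUB d a) :
    a ∈ closure d := by
  have : ProperSpace (H →L[ℂ] H) := FiniteDimensional.proper ℂ _
  have : Nonempty d := hne.to_subtype
  have : IsDirected d (· ≤ ·) := ⟨fun x y => by
    obtain ⟨z, hz, hxz, hyz⟩ := hd x x.2 y y.2
    exact ⟨⟨z, hz⟩, hxz, hyz⟩⟩
  obtain ⟨T₀⟩ : Nonempty d := inferInstance
  have hev : ∀ T : d, ∀ᶠ T' : d in Filter.atTop, (T : H →L[ℂ] H) ≤ T' :=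
    fun T => Filter.eventually_ge_atTop T
  -- As 0 ≤ a - T ≤ a - T₀ for T ≥ T₀, a tail of `d` stays in a compact ball. Its cluster point is
  -- an upper bound of `d` below `a`, hence equals `a`.
  have hball : ∀ᶠ T : d in Filter.atTop, (T : H →L[ℂ] H) ∈ Metric.closedBall a ‖a - T₀‖ := by
    filter_upwards [hev T₀] with T hT
    rw [mem_closedBall_iff_norm, norm_sub_rev]
    exact CStarAlgebra.norm_le_norm_of_nonneg_of_le (sub_nonneg.2 (ha.1 T.2))
      (sub_le_sub_left hT _)
  obtain ⟨b, -, hb⟩ := (isCompact_closedBall a ‖a - T₀‖).exists_mapClusterPt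
    (f := Filter.atTop) (u := ((↑) : d → H →L[ℂ] H)) (Filter.tendsto_principal.2 hball)
  have hbd : b ∈ closure d := by
    refine mem_closure_iff_clusterPt.2 (hb.clusterPt.mono ?_)
    rw [Filter.le_principal_iff, Filter.mem_map]
    exact Filter.univ_mem' fun T => T.2
  have hba : b ≤ a := closure_minimal (fun T hT => ha.1 hT) isClosed_Iic hbd
  have hub : b ∈ upperBounds d := fun T hT => by
    refine isClosed_Ici.closure_subset (s := Set.Ici T) ?_
    refine mem_closure_iff_clusterPt.2 (hb.clusterPt.mono ?_)
    rw [Filter.le_principal_iff, Filter.mem_map]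
    exact hev ⟨T, hT⟩
  rwa [← hba.antisymm (ha.2 hub)]

/-- In finite dimensions completely positive maps are normal. -/
theorem CompletelyPositiveMap.scottContinuous [FiniteDimensional ℂ H]
    (f : (H →L[ℂ] H) →CP (H →L[ℂ] H)) : ScottContinuous f := by
  intro d hne hd a ha
  have hmono : Monotone f := OrderHomClass.mono f
  have hcont : Continuous f := (f : (H →L[ℂ] H) →ₗ[ℂ] (H →L[ℂ] H)).continuous_of_finiteDimensional
  refine ⟨hmono.mem_upperBounds_image ha.1, fun b hb => ?_⟩
  exact closure_minimal (t := Set.Iic b) hb isClosed_Iic (image_closure_subset_closure_image hcont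
    ⟨a, DirectedOn.mem_closure_of_isLUB hne hd ha, rfl⟩)

end CompletelyPositive

/-- Multiplication by `c` is conjugation by √c. -/
theorem LinearMap.IsCompletelyPositive.smul {H : Type u} [NormedAddCommGroup H]
    [InnerProductSpace ℂ H] [CompleteSpace H] {f : (H →L[ℂ] H) →ₗ[ℂ] (H →L[ℂ] H)}
    (hf : f.IsCompletelyPositive) {c : ℝ} (hc : 0 ≤ c) :
    ((c : ℂ) • f).IsCompletelyPositive := by
  have h : (c : ℂ) • f =
      LinearMap.mulLeftRight ℂ (((√c : ℝ) : ℂ) • (1 : H →L[ℂ] H), star (((√c : ℝ) : ℂ) • 1)) * f := by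
    ext1 a
    simp [smul_smul, Real.mul_self_sqrt hc]
  rw [h]
  exact (conj _).mul hf

/-- The `cp`-semigroup over `ℕ³` generated by three commuting completely positive contractions
on a finite-dimensional Hilbert space. -/
def CPSemigroup.ofCommute {H : Type u} [NormedAddCommGroup H] [InnerProductSpace ℂ H]
    [CompleteSpace H] [FiniteDimensional ℂ H]
    (T : Fin 3 → Module.End ℂ (H →L[ℂ] H)) (hcp : ∀ i, (T i).IsCompletelyPositive)
    (hcontr : ∀ i a, ‖T i a‖ ≤ ‖a‖) (hcomm : ∀ i j, Commute (T i) (T j)) :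
    CPSemigroup (Fin 3 → ℕ) H where
  map n := (((hcp 0).pow (n 0)).mul (((hcp 1).pow (n 1)).mul ((hcp 2).pow (n 2)))).toCP
  contractive n a := by
    have hp : ∀ (i : Fin 3) (m : ℕ) (a : H →L[ℂ] H), ‖(T i ^ m) a‖ ≤ ‖a‖ := by
      intro i m
      induction m with
      | zero => exact fun a => le_rfl
      | succ m ih => exact fun a => by rw [pow_succ]; exact (ih _).trans (hcontr i a)
    exact (hp _ _ _).trans ((hp _ _ _).trans (hp _ _ _))
  normal n := CompletelyPositiveMap.scottContinuous _
  map_zero a := by simp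
  map_add m n a := by
    have h : T 0 ^ (m + n) 0 * (T 1 ^ (m + n) 1 * T 2 ^ (m + n) 2) =
        (T 0 ^ m 0 * (T 1 ^ m 1 * T 2 ^ m 2)) * (T 0 ^ n 0 * (T 1 ^ n 1 * T 2 ^ n 2)) := by
      have h01 := ((hcomm 0 1).pow_pow (n 0) (m 1)).eq
      have h02 := ((hcomm 0 2).pow_pow (n 0) (m 2)).eq
      have h12 := ((hcomm 1 2).pow_pow (n 1) (m 2)).eq
      simp only [Pi.add_apply, pow_add, mul_assoc]
      rw [← mul_assoc (T 2 ^ m 2) (T 0 ^ n 0), ← h02, mul_assoc,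
        ← mul_assoc (T 1 ^ m 1) (T 0 ^ n 0), ← h01, mul_assoc,
        ← mul_assoc (T 2 ^ m 2) (T 1 ^ n 1), ← h12, mul_assoc]
    exact LinearMap.congr_fun h a

theorem CPSemigroup.ofCommute_single {H : Type u} [NormedAddCommGroup H] [InnerProductSpace ℂ H]
    [CompleteSpace H] [FiniteDimensional ℂ H]
    (T : Fin 3 → Module.End ℂ (H →L[ℂ] H)) (hcp : ∀ i, (T i).IsCompletelyPositive)
    (hcontr : ∀ i a, ‖T i a‖ ≤ ‖a‖) (hcomm : ∀ i j, Commute (T i) (T j)) (i : Fin 3)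
    (a : H →L[ℂ] H) :
    (CPSemigroup.ofCommute T hcp hcontr hcomm).map (Pi.single i 1) a = T i a := by
  fin_cases i <;> simp [CPSemigroup.ofCommute]

/-! ### Commuting generators on a truncated Fock space -/

namespace FlipSystem

/-- A basis of `ℂ ⊕ (ℂ³ ⊗ ℂ²) ⊕ (ℂ² ⊗ ℂ²)`. -/
abbrev Index : Type := Option (Fin 3 × Fin 2) ⊕ (Fin 2 × Fin 2)

/-- The Hilbert space on which the `cp`-semigroup acts. -/
abbrev Space : Type := EuclideanSpace ℂ Index

/-- The standard basis of `Space`. -/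
def basis : OrthonormalBasis Index ℂ Space := EuclideanSpace.basisFun Index ℂ

/-- The vacuum vector. -/
def vac : Space := basis (.inl none)

/-- The basis vectors of degree one. -/
def deg1 (i : Fin 3) (k : Fin 2) : Space := basis (.inl (some (i, k)))

/-- The basis vectors of degree two. -/
def deg2 (p : Fin 2 × Fin 2) : Space := basis (.inr p)

/-- The pair `(k, l)`, flipped if the colours of its letters are the last two in the wrong
order. -/
def flipPair (i j : Fin 3) (k l : Fin 2) : Fin 2 × Fin 2 :=
  if i = 2 ∧ j = 1 then (l, k) else (k, l)

/-- The creation operators. -/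
def creation (i : Fin 3) (k : Fin 2) : Space →L[ℂ] Space :=
  InnerProductSpace.rankOne ℂ (deg1 i k) vac +
    ∑ p : Fin 3 × Fin 2, InnerProductSpace.rankOne ℂ (deg2 (flipPair i p.1 k p.2)) (deg1 p.1 p.2)

/-- The unscaled generators of the `cp`-semigroup. -/
def generator (i : Fin 3) : Module.End ℂ (Space →L[ℂ] Space) :=
  ∑ k, LinearMap.mulLeftRight ℂ (creation i k, star (creation i k))

theorem inner_vac_vac : inner ℂ vac vac = 1 := by
  simp [vac]

theorem inner_deg1 (i j : Fin 3) (k l : Fin 2) :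
    inner ℂ (deg1 i k) (deg1 j l) = if i = j ∧ k = l then 1 else 0 := by
  simp [deg1, basis.inner_eq_ite]

theorem inner_deg2 (p q : Fin 2 × Fin 2) : inner ℂ (deg2 p) (deg2 q) = if p = q then 1 else 0 := by
  simp [deg2, basis.inner_eq_ite]

theorem creation_vac (i : Fin 3) (k : Fin 2) : creation i k vac = deg1 i k := by
  simp [creation, vac, deg1, basis.inner_eq_ite]

theorem creation_deg1 (i j : Fin 3) (k l : Fin 2) :
    creation i k (deg1 j l) = deg2 (flipPair i j k l) := by
  simp [creation, vac, deg1, basis.inner_eq_ite, ite_smul]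

theorem creation_deg2 (i : Fin 3) (k : Fin 2) (p : Fin 2 × Fin 2) : creation i k (deg2 p) = 0 := by
  simp [creation, vac, deg1, deg2, basis.inner_eq_ite]

theorem creation_mul_creation (i j : Fin 3) (k l : Fin 2) :
    creation i k * creation j l =
      InnerProductSpace.rankOne ℂ (deg2 (flipPair i j k l)) vac := by
  ext1 v
  have h : creation j l v = inner ℂ vac v • deg1 j l +
      ∑ p : Fin 3 × Fin 2, inner ℂ (deg1 p.1 p.2) v • deg2 (flipPair j p.1 l p.2) := by
    simp [creation]
  rw [mul_apply_eq_comp, h]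
  simp [creation_deg1, creation_deg2]

theorem generator_apply (i : Fin 3) (a : Space →L[ℂ] Space) :
    generator i a = ∑ k, creation i k * a * star (creation i k) := by
  simp [generator]

theorem generator_rankOne (i : Fin 3) (v w : Space) :
    generator i (InnerProductSpace.rankOne ℂ v w) =
      ∑ k, InnerProductSpace.rankOne ℂ (creation i k v) (creation i k w) := by
  rw [generator_apply]
  refine Finset.sum_congr rfl fun k _ => ?_
  rw [ContinuousLinearMap.mul_def, ContinuousLinearMap.mul_def,
    InnerProductSpace.comp_rankOne, InnerProductSpace.rankOne_comp,
    ContinuousLinearMap.star_eq_adjoint, ContinuousLinearMap.adjoint_adjoint]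

/-- Only the k-th summand survives, as the vectors S_{i,l} Ω are orthonormal. Each creation operator
is thus recovered from the generator. -/
theorem generator_rankOne_vac_deg1 (i : Fin 3) (k : Fin 2) (v : Space) :
    generator i (InnerProductSpace.rankOne ℂ v vac) (deg1 i k) = creation i k v := by
  fin_cases k <;> simp [generator_rankOne, creation_vac, inner_deg1, -inner_self_eq_norm_sq_to_K]

/-- A product of two creation operators is |f⟩⟨Ω| with f a basis vector of degree two. Summed over
both letters, f runs over the whole basis, flipped or not, so the result does not depend on i and j;
this is why the generators commute. -/
theorem generator_generator (i j : Fin 3) (a : Space →L[ℂ] Space) :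
    generator i (generator j a) =
      inner ℂ vac (a vac) • ∑ p, InnerProductSpace.rankOne ℂ (deg2 p) (deg2 p) := by
  have h : ∀ k l, creation i k * (creation j l * a * star (creation j l)) * star (creation i k) =
      inner ℂ vac (a vac) • InnerProductSpace.rankOne ℂ (deg2 (flipPair i j k l))
        (deg2 (flipPair i j k l)) := by
    intro k l
    have : creation i k * (creation j l * a * star (creation j l)) * star (creation i k) =
        (creation i k * creation j l) * a * star (creation i k * creation j l) := by
      simp only [star_mul, mul_assoc]
    rw [this, creation_mul_creation, ContinuousLinearMap.star_eq_adjoint]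
    ext1 v
    simp [smul_smul, mul_comm]
  simp only [generator_apply, Finset.mul_sum, Finset.sum_mul, h, ← Finset.smul_sum]
  congr 1
  rw [Fintype.sum_prod_type]
  by_cases hij : i = 2 ∧ j = 1
  · simp only [flipPair, if_pos hij]
    exact Finset.sum_comm
  · simp only [flipPair, if_neg hij]

theorem generator_isCompletelyPositive (i : Fin 3) : (generator i).IsCompletelyPositive := by
  rw [generator, Fin.sum_univ_two]
  exact (LinearMap.IsCompletelyPositive.conj _).add (LinearMap.IsCompletelyPositive.conj _)

theorem generator_commute (i j : Fin 3) : Commute (generator i) (generator j) := by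
  refine LinearMap.ext fun a => ?_
  rw [Module.End.mul_apply, Module.End.mul_apply, generator_generator, generator_generator]

theorem exists_contractive_scale :
    ∃ s : ℝ, 0 < s ∧ ∀ i a, ‖((s : ℂ) • generator i) a‖ ≤ ‖a‖ := by
  let G : Fin 3 → ((Space →L[ℂ] Space) →L[ℂ] (Space →L[ℂ] Space)) :=
    fun i => LinearMap.toContinuousLinearMap (generator i)
  -- The summand 1 makes the common bound invertible.
  have hpos : 0 < 1 + ∑ i, ‖G i‖ := by positivity
  refine ⟨(1 + ∑ i, ‖G i‖)⁻¹, inv_pos.2 hpos, fun i a => ?_⟩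
  rw [LinearMap.smul_apply, norm_smul, Complex.norm_real, Real.norm_of_nonneg (inv_pos.2 hpos).le,
    inv_mul_le_iff₀ hpos]
  refine ((G i).le_opNorm a).trans (mul_le_mul_of_nonneg_right ?_ (norm_nonneg a))
  have := Finset.single_le_sum (fun j _ => norm_nonneg (G j)) (Finset.mem_univ i)
  linarith

/-- There is a `cp`-semigroup generated by positive multiples of the maps `generator i`. -/
theorem exists_cpSemigroup : ∃ (s : ℝ) (Θ : CPSemigroup (Fin 3 → ℕ) Space), 0 < s ∧
    ∀ i a, Θ.map (Pi.single i 1) a = (s : ℂ) • generator i a := by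
  obtain ⟨s, hs, hcontr⟩ := exists_contractive_scale
  exact ⟨s, CPSemigroup.ofCommute (fun i => (s : ℂ) • generator i)
    (fun i => (generator_isCompletelyPositive i).smul hs.le) hcontr
    (fun i j => ((generator_commute i j).smul_left _).smul_right _), hs,
    fun i a => CPSemigroup.ofCommute_single _ _ _ _ i a⟩

end FlipSystem

/-! ### Isometries and compressions -/

section Compress

variable {H : Type v} {K : Type w}
  [NormedAddCommGroup H] [InnerProductSpace ℂ H] [CompleteSpace H]
  [NormedAddCommGroup K] [InnerProductSpace ℂ K] [CompleteSpace K]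

theorem LinearIsometry.adjoint_apply_self (V : H →ₗᵢ[ℂ] K) (x : H) :
    ContinuousLinearMap.adjoint V.toContinuousLinearMap (V x) = x := by
  refine ext_inner_left ℂ fun y => ?_
  rw [ContinuousLinearMap.adjoint_inner_right]
  exact V.inner_map_map y x

/-- A vector on which the adjoint of an isometry preserves the norm is in the range. -/
theorem LinearIsometry.apply_eq_of_adjoint_apply_eq (V : H →ₗᵢ[ℂ] K) {y : K} {x : H}
    (h : ContinuousLinearMap.adjoint V.toContinuousLinearMap y = x) (hn : ‖y‖ = ‖x‖) :
    V x = y := by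
  -- With this, ‖V x - y‖² expands to ‖x‖² - 2‖x‖² + ‖x‖² = 0.
  have h1 : inner ℂ (V x) y = inner ℂ x x := by
    conv_rhs => rw [← h, ContinuousLinearMap.adjoint_inner_right, h]
    rfl
  rw [← sub_eq_zero, ← norm_eq_zero, ← sq_eq_zero_iff, @norm_sub_sq ℂ, h1, V.norm_map,
    inner_self_eq_norm_sq, hn]
  ring

theorem inner_apply_compress (V : H →ₗᵢ[ℂ] K) (T : K →L[ℂ] K) (x y : H) :
    inner ℂ (V x) (T (V y)) = inner ℂ x (compress V T y) := by
  rw [compress, ContinuousLinearMap.comp_apply, ContinuousLinearMap.adjoint_inner_right]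
  rfl

theorem compress_rankOne (V : H →ₗᵢ[ℂ] K) (u : K) (x : H) :
    compress V (InnerProductSpace.rankOne ℂ u (V x)) =
      InnerProductSpace.rankOne ℂ (ContinuousLinearMap.adjoint V.toContinuousLinearMap u) x := by
  rw [compress, InnerProductSpace.rankOne_comp, InnerProductSpace.comp_rankOne]
  congr 1
  exact V.adjoint_apply_self x

end Compress

/-! ### Intertwiners of a dilation on B(K), and the braid contradiction -/

namespace FlipSystem

open InnerProductSpace

variable {K : Type w} [NormedAddCommGroup K] [InnerProductSpace ℂ K] [CompleteSpace K]

/-- The intertwiners of an endomorphism semigroup `A` of `B(K)` which are determined by vectors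
of `Space ⊆ K`. -/
def intertwiner (V : Space →ₗᵢ[ℂ] K) (A : (K →L[ℂ] K) →⋆ₙₐ[ℂ] (K →L[ℂ] K)) (x : Space) (v : K) :
    K :=
  A (rankOne ℂ v (V vac)) (V x)

theorem inner_apply_vac {K : Type w} [NormedAddCommGroup K] [InnerProductSpace ℂ K]
    (V : Space →ₗᵢ[ℂ] K) : inner ℂ (V vac) (V vac) = (1 : ℂ) := by
  rw [V.inner_map_map, inner_vac_vac]

/-- Since |u⟩⟨Ω|* |v⟩⟨Ω| = ⟨u, v⟩ |Ω⟩⟨Ω|, multiplicativity leaves only the compression of A(|Ω⟩⟨Ω|),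
which the dilation property determines. -/
theorem inner_intertwiner (V : Space →ₗᵢ[ℂ] K) (A : (K →L[ℂ] K) →⋆ₙₐ[ℂ] (K →L[ℂ] K))
    (x y : Space) (u v : K) :
    inner ℂ (intertwiner V A x u) (intertwiner V A y v) =
      inner ℂ u v * inner ℂ x (compress V (A (rankOne ℂ (V vac) (V vac))) y) := by
  have h : star (rankOne ℂ u (V vac)) * rankOne ℂ v (V vac) =
      inner ℂ u v • rankOne ℂ (V vac) (V vac) := by
    rw [ContinuousLinearMap.star_eq_adjoint, adjoint_rankOne, ContinuousLinearMap.mul_def,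
      rankOne_comp_rankOne]
  rw [intertwiner, intertwiner, ← ContinuousLinearMap.adjoint_inner_right,
    ← ContinuousLinearMap.star_eq_adjoint, ← mul_apply_eq_comp, ← map_star,
    ← map_mul, h, map_smul, smul_apply, inner_smul_right,
    inner_apply_compress]

theorem adjoint_intertwiner (V : Space →ₗᵢ[ℂ] K) (A : (K →L[ℂ] K) →⋆ₙₐ[ℂ] (K →L[ℂ] K))
    (x : Space) (v : K) :
    ContinuousLinearMap.adjoint V.toContinuousLinearMap (intertwiner V A x v) =
      compress V (A (rankOne ℂ v (V vac))) x :=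
  rfl

theorem apply_rankOne_vac (V : Space →ₗᵢ[ℂ] K) (A : (K →L[ℂ] K) →⋆ₙₐ[ℂ] (K →L[ℂ] K))
    (v y : K) :
    A (rankOne ℂ v (V vac)) (A (rankOne ℂ (V vac) (V vac)) y) = A (rankOne ℂ v (V vac)) y := by
  rw [← mul_apply_eq_comp, ← map_mul, ContinuousLinearMap.mul_def,
    rankOne_comp_rankOne, inner_apply_vac, one_smul]

/-- A composite depends on `v` only through C(|v⟩⟨Ω|), applied to a fixed vector. Identities at v =
Ω therefore extend to every `v`. -/
theorem intertwiner_intertwiner (V : Space →ₗᵢ[ℂ] K)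
    (A B C : (K →L[ℂ] K) →⋆ₙₐ[ℂ] (K →L[ℂ] K)) (hC : ∀ T, C T = A (B T)) (x y : Space) (v : K) :
    intertwiner V A x (intertwiner V B y v) =
      C (rankOne ℂ v (V vac)) (intertwiner V A x (V y)) := by
  rw [intertwiner, intertwiner, intertwiner, ← comp_rankOne, hC,
    ← mul_apply_eq_comp, ← map_mul, ContinuousLinearMap.mul_def]

variable {V : Space →ₗᵢ[ℂ] K} {A : (Fin 3 → ℕ) → ((K →L[ℂ] K) →⋆ₙₐ[ℂ] (K →L[ℂ] K))} {c : ℝ}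

/-- The relations T_k* T_l = c δ_{kl}, which replace isometric product maps in the braid argument.
-/
theorem inner_intertwiner_deg1
    (hdil : ∀ i T, compress V (A (Pi.single i 1) T) = (c : ℂ) • generator i (compress V T))
    (i : Fin 3) (k l : Fin 2) (u v : K) :
    inner ℂ (intertwiner V (A (Pi.single i 1)) (deg1 i k) u)
        (intertwiner V (A (Pi.single i 1)) (deg1 i l) v) =
      if k = l then c * inner ℂ u v else 0 := by
  rw [inner_intertwiner, hdil, compress_rankOne, V.adjoint_apply_self,
    smul_apply, generator_rankOne_vac_deg1, creation_vac, inner_smul_right,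
    inner_deg1]
  split_ifs <;> simp_all [mul_comm]

theorem adjoint_intertwiner_deg1
    (hdil : ∀ i T, compress V (A (Pi.single i 1) T) = (c : ℂ) • generator i (compress V T))
    (i : Fin 3) (k : Fin 2) (v : K) :
    ContinuousLinearMap.adjoint V.toContinuousLinearMap
        (intertwiner V (A (Pi.single i 1)) (deg1 i k) v) =
      (c : ℂ) • creation i k (ContinuousLinearMap.adjoint V.toContinuousLinearMap v) := by
  rw [adjoint_intertwiner, hdil, compress_rankOne, smul_apply,
    generator_rankOne_vac_deg1]

theorem inner_intertwiner_deg2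
    (hadd : ∀ m n T, A (m + n) T = A m (A n T))
    (hdil : ∀ i T, compress V (A (Pi.single i 1) T) = (c : ℂ) • generator i (compress V T))
    (i j : Fin 3) (p : Fin 2 × Fin 2) :
    inner ℂ (intertwiner V (A (Pi.single i 1 + Pi.single j 1)) (deg2 p) (V vac))
        (intertwiner V (A (Pi.single i 1 + Pi.single j 1)) (deg2 p) (V vac)) =
      (c : ℂ) * c := by
  rw [inner_intertwiner, hadd, hdil, hdil, compress_rankOne, V.adjoint_apply_self, map_smul,
    generator_generator, inner_apply_vac]
  simp [inner_vac_vac, inner_deg2, ite_smul, -inner_self_eq_norm_sq_to_K]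

/-- The two vectors ξ and η satisfy ⟨ξ, ξ⟩ = ⟨η, η⟩ = ⟨ξ, η⟩ = c², so ‖ξ - η‖ = 0. -/
theorem intertwiner_deg1_deg1_vac
    (hadd : ∀ m n T, A (m + n) T = A m (A n T))
    (hdil : ∀ i T, compress V (A (Pi.single i 1) T) = (c : ℂ) • generator i (compress V T))
    (i j : Fin 3) (k l : Fin 2) :
    intertwiner V (A (Pi.single i 1)) (deg1 i k)
        (intertwiner V (A (Pi.single j 1)) (deg1 j l) (V vac)) =
      intertwiner V (A (Pi.single i 1 + Pi.single j 1)) (deg2 (flipPair i j k l)) (V vac) := by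
  set ξ := intertwiner V (A (Pi.single i 1)) (deg1 i k)
    (intertwiner V (A (Pi.single j 1)) (deg1 j l) (V vac)) with hξ
  set η := intertwiner V (A (Pi.single i 1 + Pi.single j 1)) (deg2 (flipPair i j k l)) (V vac)
    with hη
  have h1 : inner ℂ ξ ξ = (c : ℂ) * c := by
    rw [hξ, inner_intertwiner_deg1 hdil, if_pos rfl, inner_intertwiner_deg1 hdil, if_pos rfl,
      inner_apply_vac, mul_one]
  have h2 : inner ℂ η η = (c : ℂ) * c := inner_intertwiner_deg2 hadd hdil i j _
  have h3 : inner ℂ ξ η = (c : ℂ) * c := by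
    -- The image of |Ω⟩⟨Ω| fixes ξ. Moving it across the inner product leaves only P_H ξ, which the
    -- creation operators compute.
    have hfix : A (Pi.single i 1 + Pi.single j 1) (rankOne ℂ (V vac) (V vac)) ξ = ξ := by
      rw [hξ, intertwiner_intertwiner V _ _ _ (hadd _ _), apply_rankOne_vac]
    rw [hη, intertwiner, ← ContinuousLinearMap.adjoint_inner_left,
      ← ContinuousLinearMap.star_eq_adjoint, ← map_star, ContinuousLinearMap.star_eq_adjoint,
      adjoint_rankOne, hfix, ← LinearIsometry.coe_toContinuousLinearMap,
      ← ContinuousLinearMap.adjoint_inner_left, hξ,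
      adjoint_intertwiner_deg1 hdil, adjoint_intertwiner_deg1 hdil, V.adjoint_apply_self,
      creation_vac, map_smul, creation_deg1, inner_smul_left, inner_smul_left, inner_deg2,
      if_pos rfl]
    simp
  have h4 : inner ℂ η ξ = (c : ℂ) * c := by rw [← inner_conj_symm, h3]; simp
  rw [← sub_eq_zero, ← @inner_self_eq_zero ℂ]
  rw [inner_sub_left, inner_sub_right, inner_sub_right, h1, h2, h3, h4]
  ring

theorem intertwiner_deg1_deg1
    (hadd : ∀ m n T, A (m + n) T = A m (A n T))
    (hdil : ∀ i T, compress V (A (Pi.single i 1) T) = (c : ℂ) • generator i (compress V T))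
    (i j : Fin 3) (k l : Fin 2) (v : K) :
    intertwiner V (A (Pi.single i 1)) (deg1 i k)
        (intertwiner V (A (Pi.single j 1)) (deg1 j l) v) =
      intertwiner V (A (Pi.single i 1 + Pi.single j 1)) (deg2 (flipPair i j k l)) v := by
  have h := intertwiner_deg1_deg1_vac hadd hdil i j k l
  rw [intertwiner_intertwiner V _ _ _ (hadd _ _), intertwiner] at h
  rw [intertwiner_intertwiner V _ _ _ (hadd _ _), intertwiner, ← apply_rankOne_vac, h]
  exact apply_rankOne_vac V _ v _

theorem intertwiner_swap
    (hadd : ∀ m n T, A (m + n) T = A m (A n T))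
    (hdil : ∀ i T, compress V (A (Pi.single i 1) T) = (c : ℂ) • generator i (compress V T))
    (i j : Fin 3) {k l k' l' : Fin 2}
    (h : flipPair i j k l = flipPair j i k' l') (v : K) :
    intertwiner V (A (Pi.single i 1)) (deg1 i k)
        (intertwiner V (A (Pi.single j 1)) (deg1 j l) v) =
      intertwiner V (A (Pi.single j 1)) (deg1 j k')
        (intertwiner V (A (Pi.single i 1)) (deg1 i l') v) := by
  rw [intertwiner_deg1_deg1 hadd hdil, intertwiner_deg1_deg1 hadd hdil, h, add_comm]

/-- The intertwiners would satisfy relations that contradict the braid relation. -/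
theorem not_dilation
    (hadd : ∀ m n T, A (m + n) T = A m (A n T))
    (hdil : ∀ i T, compress V (A (Pi.single i 1) T) = (c : ℂ) • generator i (compress V T))
    (hc : c ≠ 0) : False := by
  have sw : ∀ (i j : Fin 3) (k l k' l' : Fin 2), flipPair i j k l = flipPair j i k' l' → ∀ v,
      intertwiner V (A (Pi.single i 1)) (deg1 i k)
        (intertwiner V (A (Pi.single j 1)) (deg1 j l) v) =
      intertwiner V (A (Pi.single j 1)) (deg1 j k')
        (intertwiner V (A (Pi.single i 1)) (deg1 i l') v) :=
    fun i j _ _ _ _ h v => intertwiner_swap hadd hdil i j h v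
  -- Both reversals of T_0^0 T_1^1 T_2^0 Ω: the left side becomes T_2^1 T_1^0 T_0^0 Ω, the right
  -- side T_2^0 T_1^0 T_0^1 Ω. Pairing with the former gives c³ = 0.
  have h1 := (sw 0 1 0 1 0 1 rfl
    (intertwiner V (A (Pi.single 2 1)) (deg1 2 0) (V vac))).symm
  rw [sw 0 2 1 0 1 0 rfl, sw 1 2 0 1 1 0 rfl, sw 1 2 1 0 0 1 rfl, sw 0 2 0 0 0 0 rfl,
    sw 0 1 0 1 0 1 rfl] at h1
  have h2 := congrArg (inner ℂ (intertwiner V (A (Pi.single 2 1)) (deg1 2 1)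
    (intertwiner V (A (Pi.single 1 1)) (deg1 1 0)
      (intertwiner V (A (Pi.single 0 1)) (deg1 0 0) (V vac))))) h1
  simp only [inner_intertwiner_deg1 hdil, inner_apply_vac] at h2
  simp [hc] at h2

end FlipSystem

/-! ### Minimal dilations act on B(K) -/

namespace EDilation

variable {S : Type u} [AddMonoid S] {H : Type v}
  [NormedAddCommGroup H] [InnerProductSpace ℂ H] [CompleteSpace H]
  {Θ : S → (H →L[ℂ] H) → (H →L[ℂ] H)} {K : Type w}
  [NormedAddCommGroup K] [InnerProductSpace ℂ K] [CompleteSpace K]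

/-- The commutant of the algebra of a dilation acts on `H` by scalars. -/
theorem exists_smul_of_mem_commutant [Nontrivial H] (D : EDilation Θ K) {T : K →L[ℂ] K}
    (hT : T ∈ D.algebra.commutant) : ∃ c : ℂ, ∀ x, T (D.incl x) = c • D.incl x := by
  obtain ⟨h, hh⟩ := exists_norm_eq H zero_le_one
  -- The scalar is ⟨h, T h⟩ for a unit vector h: `T` commutes with |x⟩⟨h|, and both sides are
  -- evaluated at h.
  refine ⟨inner ℂ h (ContinuousLinearMap.adjoint D.incl.toContinuousLinearMap (T (D.incl h))),
    fun x => ?_⟩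
  have hcomm := VonNeumannAlgebra.mem_commutant_iff.1 hT _
    (D.corner (InnerProductSpace.rankOne ℂ x h))
  have happ : ∀ v, cornerEmbed D.incl (InnerProductSpace.rankOne ℂ x h) v =
      inner ℂ h (ContinuousLinearMap.adjoint D.incl.toContinuousLinearMap v) • D.incl x := by
    intro v
    change D.incl (InnerProductSpace.rankOne ℂ x h _) = _
    rw [InnerProductSpace.rankOne_apply, map_smul]
    rfl
  have h1 := DFunLike.congr_fun hcomm (D.incl h)
  rw [mul_apply_eq_comp, mul_apply_eq_comp, happ, happ, D.incl.adjoint_apply_self,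
    inner_self_eq_norm_sq_to_K, hh] at h1
  simpa using h1.symm

/-- The closed subspace `[R H]` generated by `H` under the algebra of a dilation. -/
def orbitSpan (D : EDilation Θ K) : Submodule ℂ K :=
  (Submodule.span ℂ {v | ∃ T ∈ D.algebra, ∃ x, v = T (D.incl x)}).topologicalClosure

theorem apply_incl_mem_orbitSpan (D : EDilation Θ K) {T : K →L[ℂ] K} (hT : T ∈ D.algebra)
    (x : H) : T (D.incl x) ∈ D.orbitSpan :=
  Submodule.le_topologicalClosure _ (Submodule.subset_span ⟨T, hT, x, rfl⟩)

theorem orbitSpan_le (D : EDilation Θ K) {W : Submodule ℂ K} (hW : IsClosed (W : Set K))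
    (h : ∀ T ∈ D.algebra, ∀ x, T (D.incl x) ∈ W) : D.orbitSpan ≤ W := by
  refine Submodule.topologicalClosure_minimal _ (Submodule.span_le.2 ?_) hW
  rintro _ ⟨T, hT, x, rfl⟩
  exact h T hT x

theorem orbitSpan_le_comap (D : EDilation Θ K) {y : K →L[ℂ] K}
    (h : ∀ T ∈ D.algebra, ∀ x, y (T (D.incl x)) ∈ D.orbitSpan) :
    D.orbitSpan ≤ D.orbitSpan.comap y.toLinearMap :=
  D.orbitSpan_le ((Submodule.isClosed_topologicalClosure _).preimage y.continuous) h

/-- If the central support of `P_H` is the identity, then the dilation acts on `B(K)`. -/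
theorem IsMinimal.isOnFullAlgebra [Nontrivial H] {D : EDilation Θ K} (hD : D.IsMinimal) :
    D.IsOnFullAlgebra := by
  have hclosed : IsClosed (D.orbitSpan : Set K) := Submodule.isClosed_topologicalClosure _
  have : CompleteSpace D.orbitSpan := hclosed.completeSpace_coe
  have hz : IsStarProjection D.orbitSpan.starProjection := isStarProjection_starProjection
  have hcomm : ∀ {T y : K →L[ℂ] K}, T ∈ D.algebra → y ∈ D.algebra.commutant → ∀ v,
      y (T v) = T (y v) := fun hT hy v =>
    (DFunLike.congr_fun (VonNeumannAlgebra.mem_commutant_iff.1 hy _ hT) v).symm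
  -- R' commutes with R and acts on H by scalars, so it leaves [R H] invariant; hence the projection
  -- lies in R'' = R.
  have hmem : D.orbitSpan.starProjection ∈ D.algebra := by
    rw [VonNeumannAlgebra.IsStarProjection.mem_iff hz]
    intro y hy
    rw [Submodule.range_starProjection]
    refine D.orbitSpan_le_comap fun T hT x => ?_
    obtain ⟨c, hc⟩ := D.exists_smul_of_mem_commutant hy
    rw [hcomm hT hy, hc, map_smul]
    exact Submodule.smul_mem _ _ (D.apply_incl_mem_orbitSpan hT x)
  -- R is closed under products, so it leaves [R H] invariant.
  have hmem' : D.orbitSpan.starProjection ∈ D.algebra.commutant := by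
    rw [VonNeumannAlgebra.IsStarProjection.mem_iff hz, VonNeumannAlgebra.commutant_commutant]
    intro y hy
    rw [Submodule.range_starProjection]
    refine D.orbitSpan_le_comap fun T hT x => ?_
    exact D.apply_incl_mem_orbitSpan (mul_mem hy hT) x
  have hfix : D.orbitSpan.starProjection * cornerEmbed D.incl 1 = cornerEmbed D.incl 1 := by
    ext1 v
    exact Submodule.starProjection_eq_self_iff.2
      (D.apply_incl_mem_orbitSpan (one_mem D.algebra) _)
  have hone : D.orbitSpan.starProjection = 1 :=
    le_antisymm hz.le_one (hD.1.2 ⟨hz, hmem, hmem', hfix⟩)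
  have htop : D.orbitSpan = ⊤ := by
    rw [← Submodule.range_starProjection D.orbitSpan, hone]
    exact LinearMap.range_id
  intro T
  rw [← VonNeumannAlgebra.commutant_commutant D.algebra, VonNeumannAlgebra.mem_commutant_iff]
  intro y hy
  obtain ⟨c, hc⟩ := D.exists_smul_of_mem_commutant hy
  -- The scalar by which `y` acts on H is also its action on R H, by commutation, and [R H] = K.
  have hy1 : y = c • 1 := by
    have hle : D.orbitSpan ≤ LinearMap.ker (y - c • (1 : K →L[ℂ] K)).toLinearMap := by
      refine D.orbitSpan_le (y - c • (1 : K →L[ℂ] K)).isClosed_ker fun T hT x => ?_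
      rw [LinearMap.mem_ker]
      simp [hcomm hT hy, hc]
    rw [htop] at hle
    refine sub_eq_zero.1 (ContinuousLinearMap.ext fun v => ?_)
    exact LinearMap.mem_ker.1 (hle (Submodule.mem_top (x := v)))
  rw [hy1, smul_mul_assoc, mul_smul_comm, one_mul, mul_one]

/-- The endomorphisms of a dilation on the full algebra, as endomorphisms of `B(K)`. -/
def fullEnd (D : EDilation Θ K) (hD : D.IsOnFullAlgebra) (n : S) :
    (K →L[ℂ] K) →⋆ₙₐ[ℂ] (K →L[ℂ] K) where
  toFun T := D.α.map n ⟨T, hD T⟩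
  map_smul' c T := by
    have h := map_smul (D.α.map n) c ⟨T, hD T⟩
    exact congrArg Subtype.val h
  map_zero' := by
    have h := map_zero (D.α.map n)
    exact congrArg Subtype.val h
  map_add' T T' := by
    have h := map_add (D.α.map n) ⟨T, hD T⟩ ⟨T', hD T'⟩
    exact congrArg Subtype.val h
  map_mul' T T' := by
    have h := map_mul (D.α.map n) ⟨T, hD T⟩ ⟨T', hD T'⟩
    exact congrArg Subtype.val h
  map_star' T := by
    have h := map_star (D.α.map n) ⟨T, hD T⟩
    exact congrArg Subtype.val h

end EDilation

/-! ### Nonexistence of dilations at every scale -/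

namespace FlipSystem

theorem not_isOnFullAlgebra {K : Type w} [NormedAddCommGroup K] [InnerProductSpace ℂ K]
    [CompleteSpace K] {s : ℝ} {Θ : CPSemigroup (Fin 3 → ℕ) Space} (hs : 0 < s)
    (hΘ : ∀ i a, Θ.map (Pi.single i 1) a = (s : ℂ) • generator i a) {lam : ℝ} (hlam : 0 < lam)
    (D : EDilation (Θ.scale lam) K) : ¬ D.IsOnFullAlgebra := by
  intro hD
  refine not_dilation (V := D.incl) (A := fun n => D.fullEnd hD n) (c := lam * s)
    (fun m n T => ?_) (fun i T => ?_) (mul_pos hlam hs).ne'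
  · exact congrArg Subtype.val (D.α.map_add m n ⟨T, hD T⟩)
  · have h := D.dilates (Pi.single i 1) ⟨T, hD T⟩
    rw [CPSemigroup.scale, hΘ, Finset.sum_pi_single', if_pos (Finset.mem_univ i), pow_one,
      smul_smul, ← Complex.ofReal_mul] at h
    exact h.symm

end FlipSystem

theorem FlipSystem.exists_cpSemigroup_forall_not_dilation :
    ∃ (H : Type) (_ : NormedAddCommGroup H) (_ : InnerProductSpace ℂ H) (_ : CompleteSpace H)
      (Θ : CPSemigroup (Fin 3 → ℕ) H),
      ∀ lam : ℝ, 0 < lam →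
        ∀ (K : Type v) [NormedAddCommGroup K] [InnerProductSpace ℂ K] [CompleteSpace K],
          (¬ ∃ D : EDilation (Θ.scale lam) K, D.IsOnFullAlgebra) ∧
          (¬ ∃ D : EDilation (Θ.scale lam) K, D.IsMinimal) := by
  obtain ⟨s, Θ, hs, hΘ⟩ := exists_cpSemigroup
  refine ⟨Space, inferInstance, inferInstance, inferInstance, Θ, fun lam hlam K _ _ _ => ⟨?_, ?_⟩⟩
  · rintro ⟨D, hD⟩
    exact not_isOnFullAlgebra hs hΘ hlam D hD
  · rintro ⟨D, hD⟩
    exact not_isOnFullAlgebra hs hΘ hlam D hD.isOnFullAlgebra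

/-! ### Exchange relations in product systems -/

theorem HilbertTensor.inner_mk {E : Type u} {F : Type v}
    [NormedAddCommGroup E] [InnerProductSpace ℂ E]
    [NormedAddCommGroup F] [InnerProductSpace ℂ F] (x x' : E) (y y' : F) :
    inner ℂ (HilbertTensor.mk x y) (HilbertTensor.mk x' y') = inner ℂ x x' * inner ℂ y y' := by
  rw [HilbertTensor.mk, HilbertTensor.mk, UniformSpace.Completion.inner_coe,
    TensorProduct.inner_tmul]

namespace SubproductSystem

/-- The product of a product system is isometric. -/
theorem IsProductSystem.inner_mul {S : Type u} [AddMonoid S] {Y : SubproductSystem.{u, w} S}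
    (hY : Y.IsProductSystem) {s t r : S} (h : s + t = r) (x x' : Y.fiber s) (y y' : Y.fiber t) :
    inner ℂ (Y.mul h (HilbertTensor.mk x y)) (Y.mul h (HilbertTensor.mk x' y')) =
      inner ℂ x x' * inner ℂ y y' := by
  rw [← ContinuousLinearMap.adjoint_inner_right, ← ContinuousLinearMap.comp_apply, hY h,
    ContinuousLinearMap.id_apply, HilbertTensor.inner_mk]

theorem IsProductSystem.norm_mul {S : Type u} [AddMonoid S] {Y : SubproductSystem.{u, w} S}
    (hY : Y.IsProductSystem) {s t r : S} (h : s + t = r) (x : Y.fiber s) (y : Y.fiber t) :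
    ‖Y.mul h (HilbertTensor.mk x y)‖ = ‖x‖ * ‖y‖ := by
  have h1 := hY.inner_mul h x x y y
  simp only [inner_self_eq_norm_sq_to_K, ← mul_pow] at h1
  norm_cast at h1
  exact (sq_eq_sq₀ (norm_nonneg _) (by positivity)).1 h1

/-- Threefold products of vectors of degrees `e_i`. -/
def mul₃ (Y : SubproductSystem.{0, w} (Fin 3 → ℕ)) {i j k : Fin 3} {n : Fin 3 → ℕ}
    (h : Pi.single i 1 + Pi.single j 1 + Pi.single k 1 = n)
    (x : Y.fiber (Pi.single i 1)) (y : Y.fiber (Pi.single j 1)) (z : Y.fiber (Pi.single k 1)) :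
    Y.fiber n :=
  Y.mul h (HilbertTensor.mk (Y.mul rfl (HilbertTensor.mk x y)) z)

/-- The exchange is assumed for every target index `m`, so that it can be used at e_i + e_j and at
e_j + e_i without transport. -/
theorem mul₃_swap_left (Y : SubproductSystem.{0, w} (Fin 3 → ℕ)) {i j k : Fin 3} {n : Fin 3 → ℕ}
    (h : Pi.single i 1 + Pi.single j 1 + Pi.single k 1 = n)
    {x : Y.fiber (Pi.single i 1)} {y : Y.fiber (Pi.single j 1)}
    {y' : Y.fiber (Pi.single j 1)} {x' : Y.fiber (Pi.single i 1)}
    (hs : ∀ {m : Fin 3 → ℕ} (h₁ : Pi.single i 1 + Pi.single j 1 = m)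
      (h₂ : Pi.single j 1 + Pi.single i 1 = m),
      Y.mul h₁ (HilbertTensor.mk x y) = Y.mul h₂ (HilbertTensor.mk y' x'))
    (z : Y.fiber (Pi.single k 1)) :
    Y.mul₃ h x y z = Y.mul₃ ((congrArg (· + _) (add_comm _ _)).trans h) y' x' z := by
  have key : ∀ {m : Fin 3 → ℕ} (h₁ : Pi.single j 1 + Pi.single i 1 = m)
      (h₂ : m + Pi.single k 1 = n),
      Y.mul h₂ (HilbertTensor.mk (Y.mul h₁ (HilbertTensor.mk y' x')) z) =
        Y.mul₃ ((congrArg (· + _) (add_comm _ _)).trans h) y' x' z := by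
    intro m h₁ h₂
    subst h₁
    rfl
  rw [mul₃, hs rfl (add_comm _ _)]
  exact key _ h

theorem mul₃_swap_right (Y : SubproductSystem.{0, w} (Fin 3 → ℕ)) {i j k : Fin 3}
    {n : Fin 3 → ℕ} (h : Pi.single i 1 + Pi.single j 1 + Pi.single k 1 = n)
    (x : Y.fiber (Pi.single i 1))
    {y : Y.fiber (Pi.single j 1)} {z : Y.fiber (Pi.single k 1)}
    {z' : Y.fiber (Pi.single k 1)} {y' : Y.fiber (Pi.single j 1)}
    (hs : ∀ {m : Fin 3 → ℕ} (h₁ : Pi.single j 1 + Pi.single k 1 = m)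
      (h₂ : Pi.single k 1 + Pi.single j 1 = m),
      Y.mul h₁ (HilbertTensor.mk y z) = Y.mul h₂ (HilbertTensor.mk z' y')) :
    Y.mul₃ h x y z = Y.mul₃ ((add_right_comm _ _ _).trans h) x z' y' := by
  rw [mul₃, mul₃, Y.assoc rfl h rfl ((add_assoc _ _ _).symm.trans h), hs rfl (add_comm _ _),
    Y.assoc rfl _ (add_comm _ _) ((add_assoc _ _ _).symm.trans h)]

theorem IsProductSystem.inner_mul₃ {Y : SubproductSystem.{0, w} (Fin 3 → ℕ)}
    (hY : Y.IsProductSystem) {i j k : Fin 3} {n : Fin 3 → ℕ}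
    (h : Pi.single i 1 + Pi.single j 1 + Pi.single k 1 = n)
    (x x' : Y.fiber (Pi.single i 1)) (y y' : Y.fiber (Pi.single j 1))
    (z z' : Y.fiber (Pi.single k 1)) :
    inner ℂ (Y.mul₃ h x y z) (Y.mul₃ h x' y' z') =
      inner ℂ x x' * inner ℂ y y' * inner ℂ z z' := by
  rw [mul₃, mul₃, hY.inner_mul, hY.inner_mul]

/-- A subproduct system with flipped products is not contained in a product system. -/
theorem HasFlipFibers.not_isSubsystem {X : SubproductSystem.{0, v} (Fin 3 → ℕ)}
    (hX : X.HasFlipFibers) {Y : SubproductSystem.{0, w} (Fin 3 → ℕ)} (hY : Y.IsProductSystem) :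
    ¬ X.IsSubsystem Y := by
  rintro ⟨ι, hι⟩
  obtain ⟨φ, ψ, -, hmul⟩ := hX
  have hsum : ∀ {i j : Fin 3} {n : Fin 3 → ℕ},
      Pi.single i 1 + Pi.single j 1 = n → ∑ i, n i = 2 := by
    rintro i j n rfl
    simp [Finset.sum_add_distrib]
  have hYX : ∀ {i j : Fin 3} {n : Fin 3 → ℕ} (h : Pi.single i 1 + Pi.single j 1 = n)
      (x y : EuclideanSpace ℂ (Fin 2)),
      Y.mul h (HilbertTensor.mk (ι _ (φ i x)) (ι _ (φ j y))) =
        ι n (if i = 2 ∧ j = 1 then ψ n (hsum h) (y ⊗ₜ[ℂ] x) else ψ n (hsum h) (x ⊗ₜ[ℂ] y)) := by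
    intro i j n h x y
    -- The projection of the product onto X(n) is the product in X, of norm ‖x‖ ‖y‖. The product in
    -- Y has that norm too, so it lies in X(n).
    refine ((ι n).apply_eq_of_adjoint_apply_eq ?_ ?_).symm
    · rw [hι h, LinearIsometry.adjoint_apply_self, LinearIsometry.adjoint_apply_self,
        hmul i j n h (hsum h)]
    · rw [hY.norm_mul]
      split_ifs <;> simp [mul_comm]
  have hs : ∀ (i j : Fin 3) (x y : EuclideanSpace ℂ (Fin 2)), ¬ (i = 2 ∧ j = 1) →
      ¬ (j = 2 ∧ i = 1) → ∀ {m : Fin 3 → ℕ} (h₁ : Pi.single i 1 + Pi.single j 1 = m)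
      (h₂ : Pi.single j 1 + Pi.single i 1 = m),
      Y.mul h₁ (HilbertTensor.mk (ι _ (φ i x)) (ι _ (φ j y))) =
        Y.mul h₂ (HilbertTensor.mk (ι _ (φ j x)) (ι _ (φ i y))) := by
    intro i j x y hij hji m h₁ h₂
    rw [hYX, hYX, if_neg hij, if_neg hji]
  have hs' : ∀ (x y : EuclideanSpace ℂ (Fin 2)),
      ∀ {m : Fin 3 → ℕ} (h₁ : Pi.single 1 1 + Pi.single 2 1 = m)
      (h₂ : Pi.single 2 1 + Pi.single 1 1 = m),
      Y.mul h₁ (HilbertTensor.mk (ι _ (φ 1 x)) (ι _ (φ 2 y))) =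
        Y.mul h₂ (HilbertTensor.mk (ι _ (φ 2 y)) (ι _ (φ 1 x))) := by
    intro x y m h₁ h₂
    rw [hYX, hYX, if_neg (by decide), if_pos (by decide)]
  let a : EuclideanSpace ℂ (Fin 2) := EuclideanSpace.single 0 1
  let b : EuclideanSpace ℂ (Fin 2) := EuclideanSpace.single 1 1
  -- The two reversals of f_0(a) f_1(b) f_2(a) end in f_2(b) f_1(a) f_0(a) and f_2(a) f_1(a) f_0(b),
  -- which are orthogonal.
  have h1 := (Y.mul₃_swap_left rfl (hs 0 1 a b (by decide) (by decide)) (ι _ (φ 2 a))).symm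
  rw [Y.mul₃_swap_right _ _ (hs 0 2 b a (by decide) (by decide)),
    Y.mul₃_swap_left _ (hs' a b),
    Y.mul₃_swap_right _ _ (hs' b a),
    Y.mul₃_swap_left _ (hs 0 2 a a (by decide) (by decide)),
    Y.mul₃_swap_right _ _ (hs 0 1 a b (by decide) (by decide))] at h1
  have h2 := congrArg (inner ℂ (Y.mul₃ (by abel) (ι _ (φ 2 b)) (ι _ (φ 1 a))
    (ι _ (φ 0 a)))) h1
  rw [hY.inner_mul₃, hY.inner_mul₃] at h2
  simp only [LinearIsometry.inner_map_map, LinearIsometryEquiv.inner_map_map] at h2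
  simp [a, b, EuclideanSpace.inner_single_left] at h2

end SubproductSystem

/-! ### The flipped subproduct system, built on words -/

namespace FlipSystem

/-- The words of length `|n|` in the letters `0, 1`, provided that `|n| ≤ 2`. -/
def Word (n : Fin 3 → ℕ) : Type :=
  {l : List (Fin 2) // l.length = ∑ i, n i ∧ l.length ≤ 2}

instance (n : Fin 3 → ℕ) : Finite (Word n) :=
  ((List.finite_length_le (Fin 2) 2).subset fun _ hl => hl.2 :
    {l : List (Fin 2) | l.length = ∑ i, n i ∧ l.length ≤ 2}.Finite).to_subtype

instance (n : Fin 3 → ℕ) : Fintype (Word n) := Fintype.ofFinite _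

instance (n : Fin 3 → ℕ) : DecidableEq (Word n) := Classical.decEq _

namespace Word

theorem ext {n : Fin 3 → ℕ} {w w' : Word n} (h : w.1 = w'.1) : w = w' := Subtype.ext h

theorem val_eq_nil (w : Word 0) : w.1 = [] := List.length_eq_zero_iff.1 (by simpa using w.2.1)

instance : Unique (Word 0) where
  default := ⟨[], by simp⟩
  uniq w := ext w.val_eq_nil

/-- The degrees whose product is flipped. -/
def IsFlipped (s t : Fin 3 → ℕ) : Prop := s = Pi.single 2 1 ∧ t = Pi.single 1 1

instance (s t : Fin 3 → ℕ) : Decidable (IsFlipped s t) := inferInstanceAs (Decidable (_ ∧ _))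

/-- Cut a word of degree `s + t` into words of degrees `s` and `t`. -/
def split {s t r : Fin 3 → ℕ} (h : s + t = r) (w : Word r) : Word s × Word t :=
  have hr : w.1.length = ∑ i, s i + ∑ i, t i := by
    rw [w.2.1, ← h, ← Finset.sum_add_distrib]; rfl
  have hw := w.2.2
  -- In the flipped degrees the front of the word goes to the right-hand factor.
  if IsFlipped s t then
    (⟨w.1.drop (∑ i, t i), by simp; omega⟩, ⟨w.1.take (∑ i, t i), by simp; omega⟩)
  else (⟨w.1.take (∑ i, s i), by simp; omega⟩, ⟨w.1.drop (∑ i, s i), by simp; omega⟩)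

theorem split_injective {s t r : Fin 3 → ℕ} (h : s + t = r) : Function.Injective (split h) := by
  intro w w' hw
  refine ext ?_
  have h1 := congrArg (fun p => p.1.1) hw
  have h2 := congrArg (fun p => p.2.1) hw
  by_cases hf : IsFlipped s t
  · simp only [split, if_pos hf] at h1 h2
    rw [← List.take_append_drop (∑ i, t i) w.1, h1, h2, List.take_append_drop]
  · simp only [split, if_neg hf] at h1 h2
    rw [← List.take_append_drop (∑ i, s i) w.1, h1, h2, List.take_append_drop]

theorem not_isFlipped_zero_left (t : Fin 3 → ℕ) : ¬ IsFlipped 0 t :=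
  fun h => absurd (congrFun h.1 2) (by simp)

theorem not_isFlipped_zero_right (s : Fin 3 → ℕ) : ¬ IsFlipped s 0 :=
  fun h => absurd (congrFun h.2 1) (by simp)

theorem split_zero_left {t : Fin 3 → ℕ} (h : 0 + t = t) (w : Word t) :
    split h w = (default, w) := by
  refine Prod.ext (Subsingleton.elim _ _) (ext ?_)
  simp [split, not_isFlipped_zero_left]

theorem split_zero_right {s : Fin 3 → ℕ} (h : s + 0 = s) (w : Word s) :
    split h w = (w, default) := by
  refine Prod.ext (ext ?_) (Subsingleton.elim _ _)
  simp [split, not_isFlipped_zero_right, ← w.2.1]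

theorem eq_zero_of_sum_eq_zero {s : Fin 3 → ℕ} (h : ∑ i, s i = 0) : s = 0 := by
  ext i
  exact Finset.sum_eq_zero_iff.1 h i (Finset.mem_univ i)

/-- Words have length at most two, so one of the three degrees is zero. Associativity reduces to the
unit laws, and the flip never meets a third factor. -/
theorem split_assoc {s t r st tr str : Fin 3 → ℕ} (h₁ : s + t = st) (h₂ : st + r = str)
    (h₃ : t + r = tr) (h₄ : s + tr = str) (w : Word str) :
    (split h₁ (split h₂ w).1).1 = (split h₄ w).1 ∧
    (split h₁ (split h₂ w).1).2 = (split h₃ (split h₄ w).2).1 ∧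
    (split h₂ w).2 = (split h₃ (split h₄ w).2).2 := by
  have hsum : ∑ i, s i + ∑ i, t i + ∑ i, r i ≤ 2 := by
    rw [← Finset.sum_add_distrib, ← Finset.sum_add_distrib]
    refine le_trans (le_of_eq ?_) (w.2.1.symm.le.trans w.2.2)
    simp [← h₂, ← h₁]
  have hz : ∑ i, s i = 0 ∨ ∑ i, t i = 0 ∨ ∑ i, r i = 0 := by omega
  rcases hz with hz | hz | hz <;> obtain rfl := eq_zero_of_sum_eq_zero hz
  · obtain rfl : t = st := by simpa using h₁
    obtain rfl : tr = str := by simpa using h₄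
    simp [split_zero_left]
  · obtain rfl : s = st := by simpa using h₁
    obtain rfl : r = tr := by simpa using h₃
    simp [split_zero_left, split_zero_right]
  · obtain rfl : st = str := by simpa using h₂
    obtain rfl : t = tr := by simpa using h₃
    simp [split_zero_right]

/-- Words of degree `e_i` are letters. -/
def equivOne (i : Fin 3) : Fin 2 ≃ Word (Pi.single i 1) where
  toFun k := ⟨[k], by simp⟩
  -- The default 0 is never reached: the word has exactly one letter.
  invFun w := w.1.headD 0
  left_inv k := rfl
  right_inv w := by
    obtain ⟨k, hk⟩ := List.length_eq_one_iff.1 (w.2.1.trans (by simp))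
    exact ext (by simp [hk])

/-- Words of degree `n`, where `|n| = 2`, are pairs of letters. -/
def equivTwo (n : Fin 3 → ℕ) (hn : ∑ i, n i = 2) : Fin 2 × Fin 2 ≃ Word n where
  toFun p := ⟨[p.1, p.2], by simp [hn]⟩
  invFun w := (w.1.headD 0, w.1.tail.headD 0)
  left_inv p := rfl
  right_inv w := by
    obtain ⟨k, l, hkl⟩ := List.length_eq_two.1 (w.2.1.trans hn)
    exact ext (by simp [hkl])

theorem val_equivOne (i : Fin 3) (k : Fin 2) : (equivOne i k).1 = [k] := rfl

theorem val_equivTwo (n : Fin 3 → ℕ) (hn : ∑ i, n i = 2) (p : Fin 2 × Fin 2) :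
    (equivTwo n hn p).1 = [p.1, p.2] := rfl

theorem isFlipped_single (i j : Fin 3) :
    IsFlipped (Pi.single i 1) (Pi.single j 1) ↔ i = 2 ∧ j = 1 := by
  revert i j
  decide

theorem split_single {i j : Fin 3} {n : Fin 3 → ℕ} (h : Pi.single i 1 + Pi.single j 1 = n)
    (hn : ∑ i, n i = 2) (p : Fin 2 × Fin 2) :
    split h (equivTwo n hn p) = if i = 2 ∧ j = 1 then (equivOne i p.2, equivOne j p.1)
      else (equivOne i p.1, equivOne j p.2) := by
  simp only [split, isFlipped_single]
  split_ifs <;>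
    exact Prod.ext (ext (by simp [val_equivOne, val_equivTwo]))
      (ext (by simp [val_equivOne, val_equivTwo]))

end Word

/-- The product `X(s) ⊗ X(t) → X(s + t)`, given by concatenation of words. -/
def mul {s t r : Fin 3 → ℕ} (h : s + t = r) :
    HilbertTensor (EuclideanSpace ℂ (Word s)) (EuclideanSpace ℂ (Word t)) →L[ℂ]
      EuclideanSpace ℂ (Word r) :=
  ∑ w, InnerProductSpace.rankOne ℂ (EuclideanSpace.single w 1)
    (HilbertTensor.mk (EuclideanSpace.single (w.split h).1 1)
      (EuclideanSpace.single (w.split h).2 1))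

theorem mul_mk_apply {s t r : Fin 3 → ℕ} (h : s + t = r) (x : EuclideanSpace ℂ (Word s))
    (y : EuclideanSpace ℂ (Word t)) (w : Word r) :
    mul h (HilbertTensor.mk x y) w = x (w.split h).1 * y (w.split h).2 := by
  simp [mul, HilbertTensor.inner_mk, EuclideanSpace.inner_single_left, Pi.single_apply]

/-- Cutting is injective on words, so the adjoint sends the basis to orthonormal elementary tensors.
-/
theorem mul_comp_adjoint {s t r : Fin 3 → ℕ} (h : s + t = r) :
    mul h ∘L ContinuousLinearMap.adjoint (mul h) =
      ContinuousLinearMap.id ℂ (EuclideanSpace ℂ (Word r)) := by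
  have hadj : ∀ v, ContinuousLinearMap.adjoint (mul h) v =
      ∑ w, v w • HilbertTensor.mk (EuclideanSpace.single (w.split h).1 (1 : ℂ))
        (EuclideanSpace.single (w.split h).2 (1 : ℂ)) := by
    intro v
    simp [mul, EuclideanSpace.inner_single_left]
  ext v u
  rw [ContinuousLinearMap.comp_apply, hadj, map_sum, ContinuousLinearMap.id_apply,
    WithLp.ofLp_sum, Finset.sum_apply, Finset.sum_eq_single u]
  · simp [mul_mk_apply]
  · intro w _ hw
    have hne : ¬ ((u.split h).1 = (w.split h).1 ∧ (u.split h).2 = (w.split h).2) := fun h' =>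
      hw (Word.split_injective h (Prod.ext h'.1 h'.2)).symm
    rw [map_smul, PiLp.smul_apply, mul_mk_apply]
    simp only [PiLp.single_apply, smul_eq_mul]
    by_cases h1 : (u.split h).1 = (w.split h).1
    · rw [if_neg fun h2 => hne ⟨h1, h2⟩, mul_zero, mul_zero]
    · rw [if_neg h1, zero_mul, mul_zero]
  · simp

/-- The identification of `ℂ` with the fibre at `0`. -/
def zeroIso : ℂ ≃ₗᵢ[ℂ] EuclideanSpace ℂ (Word 0) :=
  (OrthonormalBasis.singleton Unit ℂ).repr.trans
    (LinearIsometryEquiv.piLpCongrLeft 2 ℂ ℂ (Equiv.ofUnique Unit (Word 0)))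

theorem zeroIso_apply (c : ℂ) (w : Word 0) : zeroIso c w = c := by
  simp [zeroIso, LinearIsometryEquiv.piLpCongrLeft_apply, Equiv.piCongrLeft'_apply]

/-- The subproduct system with flipped products. -/
def system : SubproductSystem.{0, 0} (Fin 3 → ℕ) where
  fiber n := EuclideanSpace ℂ (Word n)
  mul := mul
  coisometric := mul_comp_adjoint
  zeroIso := zeroIso
  zero_mul s c x := by
    ext w
    rw [mul_mk_apply, zeroIso_apply, Word.split_zero_left]
    rfl
  mul_zero s c x := by
    ext w
    rw [mul_mk_apply, zeroIso_apply, Word.split_zero_right, mul_comm]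
    rfl
  assoc h₁ h₂ h₃ h₄ x y z := by
    ext w
    obtain ⟨hx, hy, hz⟩ := Word.split_assoc h₁ h₂ h₃ h₄ w
    rw [mul_mk_apply, mul_mk_apply, mul_mk_apply, mul_mk_apply, hx, hy, hz, mul_assoc]

/-- The identification of the fibre at `e_i` with `ℂ²`. -/
def isoOne (i : Fin 3) :
    EuclideanSpace ℂ (Fin 2) ≃ₗᵢ[ℂ] EuclideanSpace ℂ (Word (Pi.single i 1)) :=
  LinearIsometryEquiv.piLpCongrLeft 2 ℂ ℂ (Word.equivOne i)

theorem isoOne_apply (i : Fin 3) (x : EuclideanSpace ℂ (Fin 2)) (k : Fin 2) :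
    isoOne i x (Word.equivOne i k) = x k := by
  simp [isoOne, LinearIsometryEquiv.piLpCongrLeft_apply, Equiv.piCongrLeft'_apply]

/-- The identification of the fibre at `n`, where `|n| = 2`, with `ℂ² ⊗ ℂ²`. -/
def isoTwo (n : Fin 3 → ℕ) (hn : ∑ i, n i = 2) :
    EuclideanSpace ℂ (Fin 2) ⊗[ℂ] EuclideanSpace ℂ (Fin 2) ≃ₗᵢ[ℂ] EuclideanSpace ℂ (Word n) :=
  ((EuclideanSpace.basisFun (Fin 2) ℂ).tensorProduct (EuclideanSpace.basisFun (Fin 2) ℂ)).repr.trans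
    (LinearIsometryEquiv.piLpCongrLeft 2 ℂ ℂ (Word.equivTwo n hn))

theorem isoTwo_apply (n : Fin 3 → ℕ) (hn : ∑ i, n i = 2) (x y : EuclideanSpace ℂ (Fin 2))
    (p : Fin 2 × Fin 2) :
    isoTwo n hn (x ⊗ₜ[ℂ] y) (Word.equivTwo n hn p) = x p.1 * y p.2 := by
  simp only [isoTwo, LinearIsometryEquiv.trans_apply, LinearIsometryEquiv.piLpCongrLeft_apply,
    Equiv.piCongrLeft'_apply, Equiv.symm_apply_apply]
  exact OrthonormalBasis.tensorProduct_repr_tmul_apply _ _ x y p.1 p.2 |>.trans (mul_comm _ _)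

theorem mul_isoOne {i j : Fin 3} {n : Fin 3 → ℕ} (h : Pi.single i 1 + Pi.single j 1 = n)
    (hn : ∑ i, n i = 2) (x y : EuclideanSpace ℂ (Fin 2)) :
    mul h (HilbertTensor.mk (isoOne i x) (isoOne j y)) =
      if i = 2 ∧ j = 1 then isoTwo n hn (y ⊗ₜ[ℂ] x) else isoTwo n hn (x ⊗ₜ[ℂ] y) := by
  ext w
  obtain ⟨p, rfl⟩ := (Word.equivTwo n hn).surjective w
  rw [mul_mk_apply, Word.split_single]
  by_cases hij : i = 2 ∧ j = 1
  · simp only [if_pos hij]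
    rw [isoTwo_apply, isoOne_apply, isoOne_apply, mul_comm]
  · simp only [if_neg hij]
    rw [isoTwo_apply, isoOne_apply, isoOne_apply]

theorem hasFlipFibers_system : system.HasFlipFibers := by
  refine ⟨isoOne, isoTwo, fun n hn => ?_, fun i j n h hn x y => ?_⟩
  · have : IsEmpty (Word n) := ⟨fun w => absurd (w.2.1.symm.le.trans w.2.2) (not_le.2 hn)⟩
    change Subsingleton (EuclideanSpace ℂ (Word n))
    infer_instance
  · exact mul_isoOne h hn x y

end FlipSystem

end

theorem mainTheorem5 :
    (∃ X : SubproductSystem.{0, 0} (Fin 3 → ℕ), X.HasFlipFibers ∧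
      ∀ Y : SubproductSystem.{0, u} (Fin 3 → ℕ), Y.IsProductSystem → ¬ X.IsSubsystem Y) ∧
    (∃ (H : Type) (_ : NormedAddCommGroup H) (_ : InnerProductSpace ℂ H) (_ : CompleteSpace H)
      (Θ : CPSemigroup (Fin 3 → ℕ) H),
      ∀ lam : ℝ, 0 < lam →
        ∀ (K : Type v) [NormedAddCommGroup K] [InnerProductSpace ℂ K] [CompleteSpace K],
          (¬ ∃ D : EDilation (Θ.scale lam) K, D.IsOnFullAlgebra) ∧
          (¬ ∃ D : EDilation (Θ.scale lam) K, D.IsMinimal)) :=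
  ⟨⟨FlipSystem.system, FlipSystem.hasFlipFibers_system,
    fun _ hY => FlipSystem.hasFlipFibers_system.not_isSubsystem hY⟩,
    FlipSystem.exists_cpSemigroup_forall_not_dilation⟩
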